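/- Let $K$ be an algebraically closed field of characteristic zero, let $G$ be a finite abelian group with character group $\hat G = \operatorname{Hom}(G, K^\times)$, and let $A$ be a left Yetter–Drinfel'd Hopf algebra over the group ring $K[G]$ with coaction $\delta(a) = a^{(1)} \otimes a^{(2)} \in K[G] \otimes A$ and antipode $S_A$. Suppose that the algebra $A$ is commutative and semisimple. (Here a left Yetter–Drinfel'd Hopf algebra is a left Yetter–Drinfel'd module $A$, i.e. a left $K[G]$-module and left $K[G]$-comodule with $\delta(h.a) = h_{(1)} a^{(1)} S(h_{(3)}) \otimes h_{(2)}.a^{(2)}$, that is also an algebra and a coalgebra such that multiplication, unit, comultiplication and counit are linear and colinear over $K[G]$, the counit is an algebra homomorphism, and the comultiplication is an algebra homomorphism into $A \otimes A$ with the product $(a \otimes a')(b \otimes b') = a (a'^{(1)}.b) \otimes a'^{(2)} b'$; and $S_A : A \to A$ is a linear map, also $K[G]$-linear and colinear, with $S_A(a_{(1)}) a_{(2)} = a_{(1)} S_A(a_{(2)}) = \varepsilon_A(a) 1_A$ for all $a \in A$.) For $g \in G$ and $\gamma \in \hat G$ set $\phi_g(a) = g.a$ and $\psi_\gamma(a)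 = \gamma(a^{(1)})\, a^{(2)}$, where $\gamma$ is extended linearly to $K[G]$. For a primitive idempotent $e \in A$ let $$Q_e = \{\gamma \in \hat G \mid \psi_\gamma(e) = e\}, \qquad Q_e^\perp = \{g \in G \mid \gamma(g) = 1 \text{ for all } \gamma \in Q_e\}, \qquad I_e = \operatorname{Span}_K\{\phi_g(e) \mid g \in Q_e^\perp\}.$$ Then $I_e$ is an ideal of $A$, and its image $S_A(I_e)$ is an ideal of $A$. Moreover, if $I \subset A$ is any ideal containing $e$ such that $S_A(I)$ is an ideal of $A$, then $I_e \subset I$. -/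

import Mathlib

open scoped TensorProduct

/-! ### Yetter-Drinfel'd modules over a Hopf algebra -/

section YetterDrinfeldModules

variable (K H V W : Type*) [Field K] [Semiring H] [HopfAlgebra K H]
  [AddCommGroup V] [Module K V] [Module H V] [IsScalarTower K H V]
  [AddCommGroup W] [Module K W] [Module H W] [IsScalarTower K H W]

/-- The action of `H` on `V` as a linear map `h ↦ (v ↦ h • v)`. -/
noncomputable def ydAction : H →ₗ[K] (V →ₗ[K] V) := (Algebra.lsmul K K V).toLinearMap

/-- The linear map `h ⊗ (h' ⊗ h'') ↦ (x ⊗ v ↦ h x S(h'') ⊗ h' • v)`. -/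
noncomputable def ydTwist : H ⊗[K] (H ⊗[K] H) →ₗ[K] (H ⊗[K] V →ₗ[K] H ⊗[K] V) :=
  TensorProduct.lift
    { toFun := fun h => TensorProduct.lift
        (LinearMap.mk₂ K
          (fun h' h'' => TensorProduct.map
            (LinearMap.mulLeft K h ∘ₗ LinearMap.mulRight K (HopfAlgebra.antipode K h''))
            (ydAction K H V h'))
          (fun a b c => by rw [map_add, TensorProduct.map_add_right])
          (fun r a c => by rw [map_smul, TensorProduct.map_smul_right])
          (fun a b c => by
            rw [← TensorProduct.map_add_left]; congr 1; ext x; simp [mul_add])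
          (fun r a c => by
            rw [← TensorProduct.map_smul_left]; congr 1; ext x; simp))
      map_add' := fun a b => by ext; simp [add_mul, TensorProduct.add_tmul]
      map_smul' := fun r a => by ext; simp [TensorProduct.smul_tmul'] }

theorem ydTwist_tmul (h h' h'' x : H) (v : V) :
    ydTwist K H V (h ⊗ₜ (h' ⊗ₜ h'')) (x ⊗ₜ v)
      = (h * (x * HopfAlgebra.antipode K h'')) ⊗ₜ[K] (h' • v) := rfl

/-- A left-left Yetter-Drinfel'd module over the Hopf algebra `H`: a left `H`-module that is
simultaneously a left `H`-comodule with coaction `δ`, such that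
`δ(h • v) = h₍₁₎ v⁽¹⁾ S(h₍₃₎) ⊗ h₍₂₎ • v⁽²⁾`. -/
class YetterDrinfeldModule where
  /-- The coaction `δ : V → H ⊗ V`. -/
  coact : V →ₗ[K] H ⊗[K] V
  coact_coassoc :
    (TensorProduct.assoc K H H V).toLinearMap ∘ₗ
        TensorProduct.map Coalgebra.comul LinearMap.id ∘ₗ coact
      = TensorProduct.map LinearMap.id coact ∘ₗ coact
  coact_counit :
    (TensorProduct.lid K V).toLinearMap ∘ₗ
        TensorProduct.map Coalgebra.counit LinearMap.id ∘ₗ coact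
      = LinearMap.id
  coact_smul : ∀ (h : H) (v : V), coact (h • v)
    = ydTwist K H V (TensorProduct.map LinearMap.id Coalgebra.comul (Coalgebra.comul (R := K) h))
        (coact v)

/-- The diagonal action of `H` on `V ⊗ W`: `h.(v ⊗ w) = h₍₁₎ • v ⊗ h₍₂₎ • w`. -/
noncomputable def ydDiagAction : H →ₗ[K] (V ⊗[K] W →ₗ[K] V ⊗[K] W) :=
  TensorProduct.homTensorHomMap (RingHom.id K) V W V W ∘ₗ
    TensorProduct.map (ydAction K H V) (ydAction K H W) ∘ₗ Coalgebra.comul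

variable [YetterDrinfeldModule K H V] [YetterDrinfeldModule K H W]

/-- The codiagonal coaction of `H` on `V ⊗ W`: `δ(v ⊗ w) = v⁽¹⁾ w⁽¹⁾ ⊗ (v⁽²⁾ ⊗ w⁽²⁾)`. -/
noncomputable def ydCodiagCoaction : V ⊗[K] W →ₗ[K] H ⊗[K] (V ⊗[K] W) :=
  TensorProduct.map (LinearMap.mul' K H) LinearMap.id ∘ₗ
    (TensorProduct.tensorTensorTensorComm K H V H W).toLinearMap ∘ₗ
    TensorProduct.map (YetterDrinfeldModule.coact (H := H)) (YetterDrinfeldModule.coact (H := H))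

/-- The quasisymmetry `σ : V ⊗ W → W ⊗ V`, `v ⊗ w ↦ v⁽¹⁾ • w ⊗ v⁽²⁾`. -/
noncomputable def ydQuasisymmetry : V ⊗[K] W →ₗ[K] W ⊗[K] V :=
  TensorProduct.map (TensorProduct.lift (ydAction K H W)) LinearMap.id ∘ₗ
    (TensorProduct.rightComm K H V W).toLinearMap ∘ₗ
    TensorProduct.map (YetterDrinfeldModule.coact (H := H)) LinearMap.id

end YetterDrinfeldModules

/-! ### Yetter-Drinfel'd Hopf algebras -/

section YetterDrinfeldHopfAlgebras

variable (K H A : Type*) [Field K] [Semiring H] [HopfAlgebra K H]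
  [Ring A] [Algebra K A] [Module H A] [IsScalarTower K H A]

/-- The multiplication of the modified tensor square of `A`:
`(a ⊗ a')(b ⊗ b') = a (a'⁽¹⁾ • b) ⊗ a'⁽²⁾ b'`, that is
`(μ ⊗ μ) ∘ (id ⊗ σ ⊗ id)`, where `σ` is the quasisymmetry. -/
noncomputable def ydTensorMul [YetterDrinfeldModule K H A] :
    (A ⊗[K] A) ⊗[K] (A ⊗[K] A) →ₗ[K] A ⊗[K] A :=
  TensorProduct.map (LinearMap.mul' K A) (LinearMap.mul' K A) ∘ₗ
    (TensorProduct.assoc K A A (A ⊗[K] A)).symm.toLinearMap ∘ₗ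
    TensorProduct.map LinearMap.id
      ((TensorProduct.assoc K A A A).toLinearMap ∘ₗ
        TensorProduct.map (ydQuasisymmetry K H A A) LinearMap.id ∘ₗ
        (TensorProduct.assoc K A A A).symm.toLinearMap) ∘ₗ
    (TensorProduct.assoc K A A (A ⊗[K] A)).toLinearMap

/-- A left Yetter-Drinfel'd Hopf algebra structure over `H` on an algebra and coalgebra `A` that is
also an `H`-module: a Yetter-Drinfel'd module structure for which multiplication, unit,
comultiplication and counit are `H`-linear and colinear, and for which the counit is an algebra
homomorphism and the comultiplication is an algebra homomorphism into the modified tensor square,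
together with an `H`-linear and colinear antipode. -/
class YetterDrinfeldHopfAlgebra [Coalgebra K A] extends YetterDrinfeldModule K H A where
  smul_mul : ∀ (h : H) (a b : A),
    h • (a * b) = LinearMap.mul' K A (ydDiagAction K H A A h (a ⊗ₜ b))
  coact_mul : ∀ a b : A,
    coact (a * b)
      = TensorProduct.map LinearMap.id (LinearMap.mul' K A) (ydCodiagCoaction K H A A (a ⊗ₜ b))
  smul_one : ∀ h : H, h • (1 : A) = Coalgebra.counit (R := K) h • (1 : A)
  coact_one : coact (1 : A) = (1 : H) ⊗ₜ (1 : A)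
  comul_smul : ∀ (h : H) (a : A),
    Coalgebra.comul (R := K) (h • a) = ydDiagAction K H A A h (Coalgebra.comul a)
  coact_comul : ∀ a : A,
    ydCodiagCoaction K H A A (Coalgebra.comul a)
      = TensorProduct.map LinearMap.id Coalgebra.comul (coact a)
  counit_smul : ∀ (h : H) (a : A),
    Coalgebra.counit (R := K) (h • a) = Coalgebra.counit (R := K) h * Coalgebra.counit (R := K) a
  coact_counit_eq : ∀ a : A,
    TensorProduct.map LinearMap.id Coalgebra.counit (coact a)
      = (1 : H) ⊗ₜ[K] (Coalgebra.counit a : K)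
  comul_mul : ∀ a b : A,
    Coalgebra.comul (R := K) (a * b)
      = ydTensorMul K H A (Coalgebra.comul a ⊗ₜ Coalgebra.comul b)
  comul_one : Coalgebra.comul (R := K) (1 : A) = 1 ⊗ₜ 1
  counit_mul : ∀ a b : A,
    Coalgebra.counit (R := K) (a * b) = Coalgebra.counit (R := K) a * Coalgebra.counit (R := K) b
  counit_one : Coalgebra.counit (R := K) (1 : A) = 1
  /-- The antipode of `A`. -/
  antipode : A →ₗ[K] A
  antipode_smul : ∀ (h : H) (a : A), antipode (h • a) = h • antipode a
  coact_antipode : ∀ a : A,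
    coact (antipode a) = TensorProduct.map LinearMap.id antipode (coact a)
  antipode_mul_id : ∀ a : A,
    LinearMap.mul' K A (TensorProduct.map antipode LinearMap.id (Coalgebra.comul a))
      = Coalgebra.counit (R := K) a • (1 : A)
  id_mul_antipode : ∀ a : A,
    LinearMap.mul' K A (TensorProduct.map LinearMap.id antipode (Coalgebra.comul a))
      = Coalgebra.counit (R := K) a • (1 : A)

end YetterDrinfeldHopfAlgebras

/-! ### The case of a group ring -/

section GroupRing

variable (K : Type*) {G V : Type*} [Field K] [Group G]
  [AddCommGroup V] [Module K V] [Module (MonoidAlgebra K G) V]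
  [IsScalarTower K (MonoidAlgebra K G) V]

/-- The representation `g ↦ φ_g` of `G` on a Yetter-Drinfel'd module over `K[G]`. -/
noncomputable def ydPhi (g : G) : V →ₗ[K] V := ydAction K (MonoidAlgebra K G) V (.single g 1)

/-- The representation `γ ↦ ψ_γ` of the character group of `G` on a Yetter-Drinfel'd module over
`K[G]`: `ψ_γ(v) = γ(v⁽¹⁾) v⁽²⁾`, where `γ` is extended linearly to `K[G]`. -/
noncomputable def ydPsi [YetterDrinfeldModule K (MonoidAlgebra K G) V] (γ : G →* Kˣ) :
    V →ₗ[K] V :=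
  (TensorProduct.lid K V).toLinearMap ∘ₗ
    TensorProduct.map
      (MonoidAlgebra.lift K K G ((Units.coeHom K).comp γ)).toLinearMap LinearMap.id ∘ₗ
    YetterDrinfeldModule.coact (H := MonoidAlgebra K G)

/-- The isotropy group `Q_e = {γ | ψ_γ(e) = e}`. -/
def ydIsotropy [YetterDrinfeldModule K (MonoidAlgebra K G) V] (e : V) : Set (G →* Kˣ) :=
  {γ | ydPsi K γ e = e}

variable {K} in
/-- For a set `Q` of characters, `Q^⊥ = {g | γ(g) = 1 for all γ ∈ Q}`. -/
def charPerp (Q : Set (G →* Kˣ)) : Set G := {g | ∀ γ ∈ Q, γ g = 1}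

variable (G) in
/-- The subspace `I_e = Span {φ_g(e) | g ∈ Q_e^⊥}`. -/
noncomputable def ydIdeal [YetterDrinfeldModule K (MonoidAlgebra K G) V] (e : V) :
    Submodule K V :=
  Submodule.span K {x | ∃ g ∈ charPerp (ydIsotropy (G := G) K e), x = ydPhi K g e}

end GroupRing

/-- A primitive idempotent: a nonzero idempotent that is not the sum of two nonzero orthogonal
idempotents. -/
def IsPrimitiveIdempotent {A : Type*} [Ring A] (e : A) : Prop :=
  IsIdempotentElem e ∧ e ≠ 0 ∧
    ∀ p q : A, IsIdempotentElem p → IsIdempotentElem q → p * q = 0 → q * p = 0 →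
      p + q = e → p = 0 ∨ q = 0

/-- A subset of a commutative ring is (the underlying set of) an ideal. -/
def IsIdealSet {A : Type*} [CommRing A] (X : Set A) : Prop := ∃ J : Ideal A, (J : Set A) = X

/-!
Write `p_g` for the projection of `A` to its component of degree `g` with respect to the coaction of
`K[G]`, so that `ψ_γ = ∑ g, γ(g) p_g`. The proof rests on three facts.

* The antipode `S` reverses products up to the braiding, `S(ab) = ∑ h, S(φ_h(b)) S(p_h(a))`
  (`ydAntipode_mul`), since both sides are convolution inverses of the multiplication on the braided
  coalgebra `A ⊗ A`. Equivalently, `S(b) S(a) = S(∑ g, p_g(a) φ_{g⁻¹}(b))`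
  (`ydAntipode_mul_ydAntipode`).
* `A` is finite-dimensional and `S` is bijective. Semisimplicity yields an integral `Λ` with
  `ε(Λ) = 1`, for which `S(a) Λ₍₁₎ ⊗ Λ₍₂₎ = a⁽¹⁾ . Λ₍₁₎ ⊗ a⁽²⁾ Λ₍₂₎`
  (`ydAntipode_smul_comul_integral`). For homogeneous `a` the right-hand side determines `a`, because
  `S(Λ₍₁₎) a Λ₍₂₎ = a` by commutativity, so `S` is injective; and multiplying the two tensor factors
  after applying `S` to the second one shows that the image of `S` is finite-dimensional. In
  particular `A e = K e` for every primitive idempotent `e`.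
* If `f` is a primitive idempotent with isotropy group `Q`, then `p_g(b) f = 0` for all `b` if
  `g ∉ Q^⊥` (`ydProj_mul_eq_zero`), while `p_g(f) f ≠ 0` if `g ∈ Q^⊥`
  (`IsPrimitiveIdempotent.ydProj_mul_self_ne_zero`).

All `f = φ_h(e)` have the same isotropy group. As `A` is commutative,
`S(b) S(f) = S(f) S(b) = S(∑ g, p_g(b) φ_{g⁻¹}(f))`, and only the terms with `g ∈ Q_e^⊥` survive, so
that `S(I_e)` is an ideal. Conversely, let `I` be an ideal containing `e` such that `S(I)` is an
ideal, and let `f = φ_g(e)` with `g ∈ Q_e^⊥`. For `b = p_{g⁻¹}(f)` the product `S(e) S(b)` is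
`S(p_{g⁻¹}(f) f)`, so that `I` contains the nonzero multiple `p_{g⁻¹}(f) f` of `f`.
-/

open scoped TensorProduct

/-! ### The grading given by a coaction of a group ring -/

section Grading

variable (K : Type*) {G V : Type*} [Field K]
  [AddCommGroup V] [Module K V]

/-- The component `K[G] ⊗ V → V` at `g`, `x ⊗ v ↦ x_g v`. -/
noncomputable def groupRingComponent (g : G) : MonoidAlgebra K G ⊗[K] V →ₗ[K] V :=
  (TensorProduct.lid K V).toLinearMap ∘ₗ
    TensorProduct.map
      (Finsupp.lapply g ∘ₗ (MonoidAlgebra.coeffLinearEquiv K).toLinearMap) LinearMap.id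

theorem groupRingComponent_single_tmul [DecidableEq G] (g h : G) (v : V) :
    groupRingComponent K g (MonoidAlgebra.single h 1 ⊗ₜ v) = if h = g then v else 0 := by
  by_cases hg : h = g <;> simp [groupRingComponent, hg]

theorem sum_single_tmul_groupRingComponent [Fintype G] (t : MonoidAlgebra K G ⊗[K] V) :
    ∑ g, MonoidAlgebra.single g (1 : K) ⊗ₜ groupRingComponent K g t = t := by
  classical
  induction t with
  | zero => simp
  | add x y hx hy => simp only [map_add, TensorProduct.tmul_add, Finset.sum_add_distrib, hx, hy]
  | tmul x v =>
    induction x using MonoidAlgebra.induction_linear with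
    | zero => simp
    | add x y hx hy =>
      simp only [map_add, TensorProduct.tmul_add, TensorProduct.add_tmul, Finset.sum_add_distrib,
        hx, hy]
    | single h r =>
      have hr : (MonoidAlgebra.single h r : MonoidAlgebra K G) = r • MonoidAlgebra.single h 1 := by
        simp
      rw [hr]
      simp only [← TensorProduct.smul_tmul', map_smul, TensorProduct.tmul_smul,
        groupRingComponent_single_tmul]
      rw [← Finset.smul_sum, Finset.sum_eq_single h] <;> simp +contextual [eq_comm]

variable [Group G] [Module (MonoidAlgebra K G) V] [IsScalarTower K (MonoidAlgebra K G) V]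

theorem ydPhi_apply (g : G) (v : V) :
    ydPhi K g v = (MonoidAlgebra.single g 1 : MonoidAlgebra K G) • v := rfl

theorem ydPhi_ydPhi (g h : G) (v : V) : ydPhi K g (ydPhi K h v) = ydPhi K (g * h) v := by
  rw [ydPhi_apply, ydPhi_apply, ydPhi_apply, smul_smul, MonoidAlgebra.single_mul_single, one_mul]

theorem ydPhi_one (v : V) : ydPhi K (1 : G) v = v := by
  rw [ydPhi_apply, ← MonoidAlgebra.one_def, one_smul]

variable [YetterDrinfeldModule K (MonoidAlgebra K G) V]

/-- The projection of a Yetter-Drinfel'd module over `K[G]` to its homogeneous component of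
degree `g`, so that `δ(v) = ∑ g, g ⊗ p_g(v)`. -/
noncomputable def ydProj (g : G) : V →ₗ[K] V :=
  groupRingComponent K g ∘ₗ YetterDrinfeldModule.coact (H := MonoidAlgebra K G)

theorem coact_eq_sum_ydProj [Fintype G] (v : V) :
    (YetterDrinfeldModule.coact v : MonoidAlgebra K G ⊗[K] V)
      = ∑ g : G, MonoidAlgebra.single g (1 : K) ⊗ₜ ydProj K g v :=
  (sum_single_tmul_groupRingComponent K _).symm

theorem ydProj_eq_of_coact_eq [Fintype G] {v : V} {f : G → V}
    (h : (YetterDrinfeldModule.coact v : MonoidAlgebra K G ⊗[K] V)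
      = ∑ g : G, MonoidAlgebra.single g (1 : K) ⊗ₜ f g) (g : G) :
    ydProj K g v = f g := by
  classical
  rw [ydProj, LinearMap.comp_apply, h, map_sum]
  simp [groupRingComponent_single_tmul]

theorem sum_ydProj [Fintype G] (v : V) : ∑ g : G, ydProj K g v = v := by
  have h := LinearMap.congr_fun
    (YetterDrinfeldModule.coact_counit (K := K) (H := MonoidAlgebra K G) (V := V)) v
  simpa [coact_eq_sum_ydProj] using h

theorem ydProj_ydProj [Fintype G] [DecidableEq G] (g h : G) (v : V) :
    ydProj K g (ydProj K h v) = if g = h then ydProj K h v else 0 := by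
  have h1 := LinearMap.congr_fun
    (YetterDrinfeldModule.coact_coassoc (K := K) (H := MonoidAlgebra K G) (V := V)) v
  have h2 := congrArg (fun t => groupRingComponent K g (groupRingComponent K h t)) h1
  simp only [LinearMap.comp_apply, coact_eq_sum_ydProj, map_sum, TensorProduct.map_tmul,
    LinearEquiv.coe_coe, MonoidAlgebra.comul_single, CommSemiring.comul_apply,
    MonoidAlgebra.lsingle_apply, TensorProduct.assoc_tmul, LinearMap.id_apply,
    TensorProduct.tmul_sum, groupRingComponent_single_tmul] at h2
  simp only [apply_ite (groupRingComponent K g), map_zero, groupRingComponent_single_tmul] at h2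
  simp at h2
  rw [← h2]
  simp [eq_comm]

theorem ydPsi_eq_sum [Fintype G] (γ : G →* Kˣ) (v : V) :
    ydPsi K γ v = ∑ g, (γ g : K) • ydProj K g v := by
  simp [ydPsi, coact_eq_sum_ydProj]

end Grading

section CommutativeGrading

variable (K : Type*) {G V : Type*} [Field K] [CommGroup G] [Fintype G]
  [AddCommGroup V] [Module K V] [Module (MonoidAlgebra K G) V]
  [IsScalarTower K (MonoidAlgebra K G) V] [YetterDrinfeldModule K (MonoidAlgebra K G) V]

theorem ydProj_ydPhi (g h : G) (v : V) : ydProj K g (ydPhi K h v) = ydPhi K h (ydProj K g v) := by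
  refine ydProj_eq_of_coact_eq K (f := fun g => ydPhi K h (ydProj K g v)) ?_ g
  rw [ydPhi_apply, YetterDrinfeldModule.coact_smul, coact_eq_sum_ydProj]
  simp [ydTwist_tmul, ydPhi_apply]

theorem ydProj_ydPsi (g : G) (γ : G →* Kˣ) (v : V) :
    ydProj K g (ydPsi K γ v) = (γ g : K) • ydProj K g v := by
  classical
  simp [ydPsi_eq_sum, ydProj_ydProj]

theorem ydPsi_ydProj (g : G) (γ : G →* Kˣ) (v : V) :
    ydPsi K γ (ydProj K g v) = (γ g : K) • ydProj K g v := by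
  classical
  simp [ydPsi_eq_sum, ydProj_ydProj]

theorem ydPsi_ydPsi (γ γ' : G →* Kˣ) (v : V) :
    ydPsi K γ (ydPsi K γ' v) = ydPsi K (γ * γ') v := by
  rw [ydPsi_eq_sum K γ, ydPsi_eq_sum K (γ * γ')]
  simp [ydProj_ydPsi, mul_smul]

theorem ydPsi_one (v : V) : ydPsi K (1 : G →* Kˣ) v = v := by
  simp [ydPsi_eq_sum, sum_ydProj]

theorem ydPsi_ydPhi (γ : G →* Kˣ) (h : G) (v : V) :
    ydPsi K γ (ydPhi K h v) = ydPhi K h (ydPsi K γ v) := by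
  simp [ydPsi_eq_sum, ydProj_ydPhi]

end CommutativeGrading

/-! ### Compatibility of the grading with the Hopf algebra structure -/

section HopfAlgebraGrading

variable (K : Type*) {G A : Type*} [Field K] [CommGroup G] [Ring A] [Algebra K A]
  [Coalgebra K A] [Module (MonoidAlgebra K G) A] [IsScalarTower K (MonoidAlgebra K G) A]
  [YetterDrinfeldHopfAlgebra K (MonoidAlgebra K G) A]

open YetterDrinfeldHopfAlgebra Coalgebra

theorem ydPhi_mul (g : G) (a b : A) : ydPhi K g (a * b) = ydPhi K g a * ydPhi K g b := by
  rw [ydPhi_apply, smul_mul (K := K)]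
  simp [ydDiagAction]
  rfl

theorem counit_ydPhi (g : G) (a : A) : counit (R := K) (ydPhi K g a) = counit (R := K) a := by
  rw [ydPhi_apply, counit_smul]
  simp

theorem comul_ydPhi (g : G) (a : A) :
    comul (R := K) (ydPhi K g a) = TensorProduct.map (ydPhi K g) (ydPhi K g) (comul a) := by
  rw [ydPhi_apply, comul_smul]
  simp [ydDiagAction]
  rfl

variable (G) in
/-- The antipode of a Yetter-Drinfel'd Hopf algebra over `K[G]`. -/
noncomputable abbrev ydAntipode : A →ₗ[K] A := antipode (K := K) (H := MonoidAlgebra K G)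

variable [Fintype G]

theorem ydProj_mul (g : G) (a b : A) :
    ydProj K g (a * b) = ∑ h, ydProj K h a * ydProj K (h⁻¹ * g) b := by
  refine ydProj_eq_of_coact_eq K (f := fun g => ∑ h, ydProj K h a * ydProj K (h⁻¹ * g) b) ?_ g
  rw [coact_mul]
  simp only [ydCodiagCoaction, LinearMap.comp_apply, TensorProduct.map_tmul, coact_eq_sum_ydProj,
    TensorProduct.sum_tmul, TensorProduct.tmul_sum, map_sum, LinearEquiv.coe_coe,
    TensorProduct.tensorTensorTensorComm_tmul, LinearMap.mul'_apply, LinearMap.id_apply,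
    MonoidAlgebra.single_mul_single, one_mul]
  rw [Finset.sum_comm]
  conv_rhs => rw [Finset.sum_comm]
  refine Finset.sum_congr rfl fun h _ => ?_
  conv_rhs => rw [← Equiv.sum_comp (Equiv.mulLeft h)]
  simp

theorem ydPsi_mul (γ : G →* Kˣ) (a b : A) : ydPsi K γ (a * b) = ydPsi K γ a * ydPsi K γ b := by
  simp only [ydPsi_eq_sum, ydProj_mul, Finset.smul_sum, Finset.sum_mul_sum]
  rw [Finset.sum_comm]
  refine Finset.sum_congr rfl fun h _ => ?_
  rw [← Equiv.sum_comp (Equiv.mulLeft h)]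
  simpa [mul_smul, smul_mul_smul_comm] using Finset.sum_congr rfl fun _ _ => smul_comm _ _ _

theorem counit_ydProj [DecidableEq G] (g : G) (a : A) :
    counit (R := K) (ydProj K g a) = if g = 1 then counit (R := K) a else 0 := by
  have h := congrArg (groupRingComponent K g)
    (coact_counit_eq (K := K) (H := MonoidAlgebra K G) a)
  simp only [coact_eq_sum_ydProj, map_sum, TensorProduct.map_tmul, LinearMap.id_apply,
    groupRingComponent_single_tmul, MonoidAlgebra.one_def] at h
  simpa [eq_comm] using h

theorem comul_ydProj (g : G) (a : A) :
    comul (R := K) (ydProj K g a)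
      = ∑ h, TensorProduct.map (ydProj K h) (ydProj K (h⁻¹ * g)) (comul a) := by
  classical
  have h := congrArg (groupRingComponent K g) (coact_comul (K := K) (H := MonoidAlgebra K G) a)
  simp only [coact_eq_sum_ydProj, map_sum, TensorProduct.map_tmul, LinearMap.id_apply,
    groupRingComponent_single_tmul] at h
  simp only [Finset.sum_ite_eq', Finset.mem_univ, if_true] at h
  rw [← h]
  generalize (comul (R := K) a) = t
  induction t with
  | zero => simp
  | add x y hx hy => simp only [map_add, hx, hy, Finset.sum_add_distrib]
  | tmul x y =>
    simp only [ydCodiagCoaction, LinearMap.comp_apply, TensorProduct.map_tmul, coact_eq_sum_ydProj,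
      TensorProduct.sum_tmul, TensorProduct.tmul_sum, map_sum, LinearEquiv.coe_coe,
      TensorProduct.tensorTensorTensorComm_tmul, LinearMap.mul'_apply, LinearMap.id_apply,
      MonoidAlgebra.single_mul_single, one_mul, groupRingComponent_single_tmul]
    rw [Finset.sum_comm]
    refine Finset.sum_congr rfl fun h _ => ?_
    rw [← Equiv.sum_comp (Equiv.mulLeft h⁻¹)]
    simp

theorem ydAntipode_ydProj (g : G) (a : A) :
    ydAntipode K G (ydProj K g a) = ydProj K g (ydAntipode K G a) := by
  symm
  refine ydProj_eq_of_coact_eq K (f := fun g => ydAntipode K G (ydProj K g a)) ?_ g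
  rw [coact_antipode, coact_eq_sum_ydProj]
  simp

theorem ydTensorMul_tmul (a a' b b' : A) :
    ydTensorMul K (MonoidAlgebra K G) A ((a ⊗ₜ a') ⊗ₜ (b ⊗ₜ b'))
      = ∑ g : G, (a * ydPhi K g b) ⊗ₜ (ydProj K g a' * b') := by
  simp [ydTensorMul, ydQuasisymmetry, coact_eq_sum_ydProj, TensorProduct.sum_tmul,
    TensorProduct.tmul_sum]
  rfl

end HopfAlgebraGrading

/-! ### Sweedler sums -/

section Sweedler

open Coalgebra

variable (K : Type*) {C M : Type*} [Field K] [AddCommGroup C] [Module K C] [Coalgebra K C]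
  [AddCommGroup M]

/-- The Sweedler sum `F a₍₁₎ a₍₂₎`, evaluated on a chosen representative of `Δ(a)`. It is
independent of this choice if `F` is bilinear. -/
noncomputable def sweedler (a : C) (F : C → C → M) : M :=
  ∑ i ∈ (ℛ K a).index, F ((ℛ K a).left i) ((ℛ K a).right i)

theorem sweedler_sum {ι : Type*} (s : Finset ι) (a : C) (F : ι → C → C → M) :
    sweedler K a (fun x y => ∑ g ∈ s, F g x y) = ∑ g ∈ s, sweedler K a (F g) :=
  Finset.sum_comm

theorem sweedler_comm (a b : C) (F : C → C → C → C → M) :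
    sweedler K a (fun x y => sweedler K b (fun z w => F x y z w))
      = sweedler K b (fun z w => sweedler K a (fun x y => F x y z w)) :=
  Finset.sum_comm

theorem sweedler_comm_coassoc_left (a b : C) (F : C → C → C → C → C → C → M) :
    sweedler K a (fun w z => sweedler K w (fun x y =>
      sweedler K b (fun w' z' => sweedler K w' (fun x' y' => F x y z x' y' z'))))
    = sweedler K b (fun w' z' => sweedler K w' (fun x' y' =>
      sweedler K a (fun w z => sweedler K w (fun x y => F x y z x' y' z')))) := by
  simp_rw [sweedler_comm K _ b]
  refine congrArg (sweedler K b) (funext₂ fun v u' => ?_)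
  simp_rw [sweedler_comm K _ v]

theorem sweedler_comm_coassoc_right (a b : C) (F : C → C → C → C → C → C → M) :
    sweedler K a (fun x w => sweedler K w (fun y z =>
      sweedler K b (fun w' z' => sweedler K w' (fun x' y' => F x y z x' y' z'))))
    = sweedler K b (fun w' z' => sweedler K w' (fun x' y' =>
      sweedler K a (fun x w => sweedler K w (fun y z => F x y z x' y' z')))) := by
  simp_rw [sweedler_comm K _ b]
  refine congrArg (sweedler K b) (funext₂ fun v u' => ?_)
  simp_rw [sweedler_comm K _ v]

variable [Module K M]

theorem sweedler_map {N : Type*} [AddCommGroup N] [Module K N] (f : M →ₗ[K] N) (a : C)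
    (F : C → C → M) : f (sweedler K a F) = sweedler K a (fun x y => f (F x y)) :=
  map_sum _ _ _

theorem sweedler_counit_left (a : C) (f : C →ₗ[K] M) :
    sweedler K a (fun x y => counit (R := K) x • f y) = f a := by
  rw [← congrArg f (sum_counit_smul (ℛ K a))]
  simp [sweedler]

theorem sweedler_counit_right (a : C) (f : C →ₗ[K] M) :
    sweedler K a (fun x y => counit (R := K) y • f x) = f a := by
  have h := congrArg (TensorProduct.rid K C) (sum_tmul_counit_eq (R := K) (ℛ K a))
  simp only [map_sum, TensorProduct.rid_tmul, one_smul] at h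
  conv_rhs => rw [← h]
  simp [sweedler]

variable {A : Type*} [Ring A]

theorem sweedler_mul_left (a : C) (F : C → C → A) (c : A) :
    c * sweedler K a F = sweedler K a (fun x y => c * F x y) :=
  Finset.mul_sum _ _ _

theorem sweedler_mul_right (a : C) (F : C → C → A) (c : A) :
    sweedler K a F * c = sweedler K a (fun x y => F x y * c) :=
  Finset.sum_mul _ _ _

variable [Algebra K A]

theorem sweedler_coassoc (a : C) (P Q R : C →ₗ[K] A) :
    sweedler K a (fun x w => sweedler K w (fun y z => P x * (Q y * R z)))
      = sweedler K a (fun w z => sweedler K w (fun x y => P x * (Q y * R z))) := by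
  have h := congrArg (LinearMap.mul' K A ∘ₗ TensorProduct.map LinearMap.id (LinearMap.mul' K A))
    (sum_map_tmul_tmul_eq P Q R a (repr := ℛ K a) (a₁ := fun i => ℛ K _) (a₂ := fun i => ℛ K _))
  simpa [sweedler] using h

theorem sweedler_mul_eq_map (a : C) (P Q : C →ₗ[K] A) :
    sweedler K a (fun x y => P x * Q y)
      = LinearMap.mul' K A (TensorProduct.map P Q (comul a)) := by
  rw [← (ℛ K a).eq]
  simp [sweedler]

end Sweedler

/-! ### The antipode of a product -/

section AntipodeMul

variable (K : Type*) {G A : Type*} [Field K] [CommGroup G] [Ring A] [Algebra K A]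
  [Coalgebra K A] [Module (MonoidAlgebra K G) A] [IsScalarTower K (MonoidAlgebra K G) A]
  [YetterDrinfeldHopfAlgebra K (MonoidAlgebra K G) A]

open YetterDrinfeldHopfAlgebra Coalgebra

theorem sweedler_ydPhi (g : G) (a : A) (P Q : A →ₗ[K] A) :
    sweedler K (ydPhi K g a) (fun x y => P x * Q y)
      = sweedler K a (fun x y => P (ydPhi K g x) * Q (ydPhi K g y)) := by
  rw [sweedler_mul_eq_map, comul_ydPhi, ← LinearMap.comp_apply (TensorProduct.map P Q),
    ← TensorProduct.map_comp, ← sweedler_mul_eq_map]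
  rfl

variable [Fintype G]

theorem sweedler_ydProj (g : G) (a : A) (P Q : A →ₗ[K] A) :
    sweedler K (ydProj K g a) (fun x y => P x * Q y)
      = ∑ h, sweedler K a (fun x y => P (ydProj K h x) * Q (ydProj K (h⁻¹ * g) y)) := by
  simp only [sweedler_mul_eq_map, comul_ydProj, map_sum]
  refine Finset.sum_congr rfl fun h _ => ?_
  rw [← LinearMap.comp_apply (TensorProduct.map P Q),
    ← TensorProduct.map_comp, ← sweedler_mul_eq_map]
  rfl

theorem sum_sweedler_ydAntipode_mul [DecidableEq G] (g : G) (a : A) :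
    ∑ h, sweedler K a (fun x y => ydAntipode K G (ydProj K h x) * ydProj K (h⁻¹ * g) y)
      = (if g = 1 then counit (R := K) a else 0) • (1 : A) := by
  have h := antipode_mul_id (K := K) (H := MonoidAlgebra K G) (ydProj K g a)
  rw [← sweedler_mul_eq_map, sweedler_ydProj, counit_ydProj] at h
  exact h

theorem comul_mul_eq_sweedler (a b : A) :
    comul (R := K) (a * b) = sweedler K a (fun x y => sweedler K b (fun z w =>
      ∑ g : G, (x * ydPhi K g z) ⊗ₜ (ydProj K g y * w))) := by
  rw [comul_mul (H := MonoidAlgebra K G), ← (ℛ K a).eq, ← (ℛ K b).eq]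
  simp [sweedler, TensorProduct.sum_tmul, TensorProduct.tmul_sum, ydTensorMul_tmul]
  exact Finset.sum_comm

variable (G) in
/-- On the braided coalgebra `A ⊗ A`, the map `a ⊗ b ↦ S(ab)` is a right convolution inverse of the
multiplication. -/
theorem sum_sweedler_mul_ydAntipode (a b : A) :
    ∑ g : G, sweedler K a (fun x y => sweedler K b (fun z w =>
      x * (ydPhi K g z * ydAntipode K G (ydProj K g y * w))))
      = (counit (R := K) a * counit (R := K) b) • (1 : A) := by
  have h := id_mul_antipode (K := K) (H := MonoidAlgebra K G) (a * b)
  rw [comul_mul_eq_sweedler (G := G) K,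
    YetterDrinfeldHopfAlgebra.counit_mul (K := K) (H := MonoidAlgebra K G)] at h
  rw [← h]
  simp only [sweedler_map, map_sum, TensorProduct.map_tmul, LinearMap.mul'_apply, sweedler_sum,
    LinearMap.id_apply, mul_assoc]

/-- The identity `sum_sweedler_mul_ydAntipode` for `p_k(a)` in place of `a`. -/
theorem sum_sweedler_ydProj_mul_ydAntipode (k : G) (a b : A) :
    ∑ g, sweedler K a (fun x y => sweedler K b (fun z w =>
      ydProj K (k * g⁻¹) x * (ydPhi K g z * ydAntipode K G (ydProj K g y * w))))
      = (counit (R := K) (ydProj K k a) * counit (R := K) b) • (1 : A) := by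
  classical
  rw [← sum_sweedler_mul_ydAntipode K G]
  refine Finset.sum_congr rfl fun g _ => ?_
  rw [sweedler_comm K a b, sweedler_comm K (ydProj K k a) b]
  refine congrArg (sweedler K b) (funext₂ fun z w => ?_)
  have := sweedler_ydProj K k a LinearMap.id
    (LinearMap.mulLeft K (ydPhi K g z) ∘ₗ ydAntipode K G ∘ₗ LinearMap.mulRight K w ∘ₗ ydProj K g)
  simp only [LinearMap.comp_apply, LinearMap.id_apply, LinearMap.mulLeft_apply,
    LinearMap.mulRight_apply] at this
  rw [this, Finset.sum_eq_single (k * g⁻¹)]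
  · simp [ydProj_ydProj]
  · intro h _ hh
    have : g ≠ h⁻¹ * k := fun e => hh (by rw [e]; group)
    simp [ydProj_ydProj, this, sweedler]
  · simp

variable (G) in
/-- The map `(b, a) ↦ S(a⁽¹⁾ . b) S(a⁽²⁾)`. -/
noncomputable def ydAntipodeTwist : A →ₗ[K] A →ₗ[K] A :=
  ∑ h : G, (LinearMap.mul K A).compl₁₂ (ydAntipode K G ∘ₗ ydPhi K h) (ydAntipode K G ∘ₗ ydProj K h)

theorem ydAntipodeTwist_apply (a b : A) : ydAntipodeTwist K G b a
    = ∑ h : G, ydAntipode K G (ydPhi K h b) * ydAntipode K G (ydProj K h a) := by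
  simp [ydAntipodeTwist]

variable (G) in
/-- On the braided coalgebra `A ⊗ A`, the map `a ⊗ b ↦ S(a⁽¹⁾ . b) S(a⁽²⁾)` is a left convolution
inverse of the multiplication. -/
theorem sum_sweedler_ydAntipodeTwist_mul (a b : A) :
    ∑ k : G, sweedler K a (fun x y => sweedler K b (fun z w =>
      ydAntipodeTwist K G (ydPhi K k z) x * (ydProj K k y * w)))
      = (counit (R := K) a * counit (R := K) b) • (1 : A) := by
  classical
  have key : ∀ z w : A, ∑ k : G, sweedler K a (fun x y =>
      ydAntipodeTwist K G (ydPhi K k z) x * (ydProj K k y * w))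
      = counit (R := K) a • (ydAntipode K G z * w) := by
    intro z w
    have h1 : ∀ u : G, ydAntipode K G (ydPhi K u z) *
        (∑ h, sweedler K a (fun x y =>
          ydAntipode K G (ydProj K h x) * ydProj K (h⁻¹ * u) y)) * w
        = if u = 1 then counit (R := K) a • (ydAntipode K G z * w) else 0 := by
      intro u
      rw [sum_sweedler_ydAntipode_mul]
      split_ifs with hu
      · simp [hu, ydPhi_one]
      · simp
    have h2 := Finset.sum_congr (rfl : (Finset.univ : Finset G) = _) fun u _ => h1 u
    rw [Finset.sum_ite_eq' Finset.univ (1 : G), if_pos (Finset.mem_univ _)] at h2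
    rw [← h2]
    simp only [Finset.mul_sum, Finset.sum_mul, sweedler_mul_left, sweedler_mul_right,
      ydAntipodeTwist_apply, sweedler_sum, ydPhi_ydPhi]
    rw [Finset.sum_comm]
    conv_rhs => rw [Finset.sum_comm]
    refine Finset.sum_congr rfl fun h _ => ?_
    conv_rhs => rw [← Equiv.sum_comp (Equiv.mulLeft h)]
    simp [mul_assoc]
  simp_rw [sweedler_comm K a b]
  rw [← sweedler_sum]
  simp only [key]
  have := antipode_mul_id (K := K) (H := MonoidAlgebra K G) b
  rw [← sweedler_mul_eq_map] at this
  rw [mul_smul, ← this, ← LinearMap.lsmul_apply (R := K), sweedler_map]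
  rfl

variable (G) in
/-- The antipode is antimultiplicative up to the braiding: `S(ab) = S(a⁽¹⁾ . b) S(a⁽²⁾)`. Both sides
are convolution inverses of the multiplication on the braided coalgebra `A ⊗ A`. -/
theorem ydAntipode_mul (a b : A) : ydAntipode K G (a * b)
    = ∑ h : G, ydAntipode K G (ydPhi K h b) * ydAntipode K G (ydProj K h a) := by
  classical
  rw [← ydAntipodeTwist_apply]
  -- the threefold convolution product of `ydAntipodeTwist`, the multiplication and `a ⊗ b ↦ S(ab)`;
  -- `h1` contracts its last two factors, `h2` its first two factors
  have h1 : ∑ l : G, ∑ m : G, sweedler K a (fun x w => sweedler K w (fun y y' =>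
      sweedler K b (fun z v => sweedler K v (fun u u' =>
        ydAntipodeTwist K G (ydPhi K (m * l) z) x *
          (ydProj K m y * (ydPhi K l u * ydAntipode K G (ydProj K l y' * u')))))))
      = ydAntipodeTwist K G b a := by
    have key : ∀ k : G, ∑ l : G, sweedler K a (fun x w => sweedler K w (fun y y' =>
        sweedler K b (fun z v => sweedler K v (fun u u' =>
          ydAntipodeTwist K G (ydPhi K (k * l⁻¹ * l) z) x *
            (ydProj K (k * l⁻¹) y * (ydPhi K l u * ydAntipode K G (ydProj K l y' * u')))))))
        = sweedler K a (fun x w => sweedler K b (fun z v =>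
          (counit (R := K) (ydProj K k w) * counit (R := K) v) •
            ydAntipodeTwist K G (ydPhi K k z) x)) := by
      intro k
      have h : ∀ x w z v : A, (counit (R := K) (ydProj K k w) * counit (R := K) v) •
            ydAntipodeTwist K G (ydPhi K k z) x
          = ydAntipodeTwist K G (ydPhi K k z) x *
            ∑ l : G, sweedler K w (fun y y' => sweedler K v (fun u u' =>
              ydProj K (k * l⁻¹) y * (ydPhi K l u * ydAntipode K G (ydProj K l y' * u')))) := by
        intro x w z v
        rw [sum_sweedler_ydProj_mul_ydAntipode, mul_smul_comm, mul_one]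
      simp only [h, Finset.mul_sum, sweedler_mul_left, sweedler_sum, inv_mul_cancel_right]
      exact Finset.sum_congr rfl fun l _ => congrArg (sweedler K a)
        (funext₂ fun x w => sweedler_comm K w b _)
    have h := Finset.sum_congr (rfl : (Finset.univ : Finset G) = _) fun k _ => key k
    rw [Finset.sum_comm] at h
    calc _ = _ := Finset.sum_congr rfl fun l _ => by
          rw [← Equiv.sum_comp (Equiv.mulRight l⁻¹)]
          rfl
      _ = _ := h
      _ = sweedler K a (fun x w => counit (R := K) w • sweedler K b (fun z v =>
            counit (R := K) v • ydAntipodeTwist K G z x)) := by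
          simp only [counit_ydProj, ← sweedler_sum, ite_mul, zero_mul, ite_smul, zero_smul,
            Finset.sum_ite_eq', Finset.mem_univ, if_true, ydPhi_one, mul_smul]
          simp only [← LinearMap.lsmul_apply (R := K), sweedler_map]
      _ = _ := by
          simp only [fun x => sweedler_counit_right K b ((ydAntipodeTwist K G).flip x),
            ← LinearMap.flip_apply (ydAntipodeTwist K G)]
          exact sweedler_counit_right K a (ydAntipodeTwist K G b)
  have h2 : ∑ l : G, ∑ m : G, sweedler K a (fun w y' => sweedler K w (fun x y =>
      sweedler K b (fun v u' => sweedler K v (fun z u =>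
        ydAntipodeTwist K G (ydPhi K (m * l) z) x *
          ((ydProj K m y * ydPhi K l u) * ydAntipode K G (ydProj K l y' * u'))))))
      = ydAntipode K G (a * b) := by
    have key : ∀ l : G, ∑ m : G, sweedler K a (fun w y' => sweedler K w (fun x y =>
        sweedler K b (fun v u' => sweedler K v (fun z u =>
          ydAntipodeTwist K G (ydPhi K (m * l) z) x *
            ((ydProj K m y * ydPhi K l u) * ydAntipode K G (ydProj K l y' * u'))))))
        = ydAntipode K G (ydProj K l a * b) := by
      intro l
      have h : ∀ w v : A, ∑ m : G, sweedler K w (fun x y => sweedler K v (fun z u =>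
          ydAntipodeTwist K G (ydPhi K (m * l) z) x * (ydProj K m y * ydPhi K l u)))
          = (counit (R := K) w * counit (R := K) v) • (1 : A) := by
        intro w v
        rw [← counit_ydPhi K l v, ← sum_sweedler_ydAntipodeTwist_mul K G w (ydPhi K l v)]
        refine Finset.sum_congr rfl fun m _ => congrArg (sweedler K w) (funext₂ fun x y => ?_)
        have := sweedler_ydPhi K l v ((ydAntipodeTwist K G).flip x ∘ₗ ydPhi K m)
          (LinearMap.mulLeft K (ydProj K m y))
        simpa [ydPhi_ydPhi] using this.symm
      calc _ = sweedler K a (fun w y' => sweedler K b (fun v u' =>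
            (∑ m : G, sweedler K w (fun x y => sweedler K v (fun z u =>
              ydAntipodeTwist K G (ydPhi K (m * l) z) x * (ydProj K m y * ydPhi K l u))))
              * ydAntipode K G (ydProj K l y' * u'))) := by
            simp only [Finset.sum_mul, sweedler_mul_right, sweedler_sum, mul_assoc]
            exact Finset.sum_congr rfl fun l _ => congrArg (sweedler K a)
              (funext₂ fun w y' => sweedler_comm K w b _)
        _ = sweedler K a (fun w y' => counit (R := K) w • sweedler K b (fun v u' =>
            counit (R := K) v • ydAntipode K G (ydProj K l y' * u'))) := by
            simp only [h, smul_mul_assoc, one_mul, mul_smul]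
            simp only [← LinearMap.lsmul_apply (R := K), sweedler_map]
        _ = _ := by
            have e1 : ∀ y' : A, sweedler K b (fun v u' =>
                counit (R := K) v • ydAntipode K G (ydProj K l y' * u'))
                = ydAntipode K G (ydProj K l y' * b) := fun y' =>
              sweedler_counit_left K b (ydAntipode K G ∘ₗ LinearMap.mulLeft K (ydProj K l y'))
            simp only [e1]
            exact sweedler_counit_left K a
              (ydAntipode K G ∘ₗ LinearMap.mulRight K b ∘ₗ ydProj K l)
    simp only [key]
    rw [← map_sum, ← Finset.sum_mul, sum_ydProj]
  rw [← h1, ← h2]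
  refine Finset.sum_congr rfl fun l _ => Finset.sum_congr rfl fun m _ => ?_
  rw [sweedler_comm_coassoc_left]
  have ha : ∀ z u u' : A, _ := fun z u u' => sweedler_coassoc K a
    (ydAntipodeTwist K G (ydPhi K (m * l) z))
    (LinearMap.mulRight K (ydPhi K l u) ∘ₗ ydProj K m)
    (ydAntipode K G ∘ₗ LinearMap.mulRight K u' ∘ₗ ydProj K l)
  have hb : ∀ x y y' : A, _ := fun x y y' => sweedler_coassoc K b
    ((ydAntipodeTwist K G).flip x ∘ₗ ydPhi K (m * l))
    (LinearMap.mulLeft K (ydProj K m y) ∘ₗ ydPhi K l)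
    (ydAntipode K G ∘ₗ LinearMap.mulLeft K (ydProj K l y'))
  simp only [LinearMap.comp_apply, LinearMap.flip_apply, LinearMap.mulLeft_apply,
    LinearMap.mulRight_apply] at ha hb
  simp only [← ha]
  rw [← sweedler_comm_coassoc_right]
  simp only [mul_assoc] at hb ⊢
  simp only [hb]

end AntipodeMul

/-! ### Integrals and the bijectivity of the antipode -/

/-- In a commutative semisimple algebra with an augmentation `ε`, a complement of the augmentation
ideal contains a normalized integral. -/
theorem exists_integral {K A : Type*} [Field K] [CommRing A] [Algebra K A] [IsSemisimpleRing A]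
    (ε : A →ₐ[K] K) : ∃ Λ : A, ε Λ = 1 ∧ ∀ a : A, a * Λ = ε a • Λ := by
  obtain ⟨C, hC⟩ := exists_isCompl (RingHom.ker ε)
  obtain ⟨u, hu, Λ, hΛ, h1⟩ := Submodule.mem_sup.1
    (hC.sup_eq_top ▸ Submodule.mem_top : (1 : A) ∈ RingHom.ker ε ⊔ C)
  rw [RingHom.mem_ker] at hu
  refine ⟨Λ, ?_, fun a => ?_⟩
  · rw [← map_one ε, ← h1, map_add, hu, zero_add]
  · have ha : a - ε a • 1 ∈ RingHom.ker ε := by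
      rw [RingHom.mem_ker, map_sub, map_smul, map_one, smul_eq_mul, mul_one, sub_self]
    have h0 : (a - ε a • 1) * Λ = 0 :=
      Submodule.disjoint_def.1 hC.disjoint _ (Ideal.mul_mem_right _ _ ha) (C.mul_mem_left _ hΛ)
    rwa [sub_mul, smul_one_mul, sub_eq_zero] at h0

section Integral

variable (K : Type*) {G A : Type*} [Field K] [CommGroup G] [CommRing A] [Algebra K A]
  [Coalgebra K A] [Module (MonoidAlgebra K G) A] [IsScalarTower K (MonoidAlgebra K G) A]
  [YetterDrinfeldHopfAlgebra K (MonoidAlgebra K G) A]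

open YetterDrinfeldHopfAlgebra Coalgebra

variable (G A) in
/-- The counit of a Yetter-Drinfel'd Hopf algebra over `K[G]` as an algebra homomorphism. -/
noncomputable def ydCounit : A →ₐ[K] K :=
  AlgHom.ofLinearMap counit (YetterDrinfeldHopfAlgebra.counit_one (H := MonoidAlgebra K G))
    (YetterDrinfeldHopfAlgebra.counit_mul (H := MonoidAlgebra K G))

variable (G) in
theorem sweedler_ydAntipode_smul_comul (a : A) :
    sweedler K a (fun x y => ydAntipode K G x • comul (R := K) y) = (1 : A) ⊗ₜ[K] a := by
  have h := congrArg (LinearMap.rTensor A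
      (LinearMap.mul' K A ∘ₗ TensorProduct.map (ydAntipode K G) LinearMap.id))
    (coassoc_symm_apply (R := K) a)
  have hS : (LinearMap.mul' K A ∘ₗ TensorProduct.map (ydAntipode K G) LinearMap.id) ∘ₗ
      comul (R := K) = (Algebra.linearMap K A) ∘ₗ counit := by
    ext x
    simpa [Algebra.algebraMap_eq_smul_one] using
      antipode_mul_id (K := K) (H := MonoidAlgebra K G) x
  rw [← LinearMap.rTensor_comp_apply, hS,
    LinearMap.rTensor_comp_apply A (Algebra.linearMap K A) counit, rTensor_counit_comul,
    LinearMap.rTensor_tmul, Algebra.linearMap_apply, map_one] at h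
  rw [← h, sweedler]
  conv_rhs => rw [← (ℛ K a).eq]
  simp only [map_sum, LinearMap.lTensor_tmul]
  refine Finset.sum_congr rfl fun i _ => ?_
  generalize comul (R := K) ((ℛ K a).right i) = t
  induction t with
  | zero => simp
  | add x y hx hy => simp only [smul_add, TensorProduct.tmul_add, map_add, hx, hy]
  | tmul x y => simp [TensorProduct.smul_tmul']

variable [Fintype G]

variable (G) in
theorem smul_ydTensorMul (s : A) (u t : A ⊗[K] A) :
    s • ydTensorMul K (MonoidAlgebra K G) A (u ⊗ₜ t)
      = ydTensorMul K (MonoidAlgebra K G) A ((s • u) ⊗ₜ t) := by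
  induction t with
  | zero => simp
  | add x y hx hy => simp only [TensorProduct.tmul_add, map_add, smul_add, hx, hy]
  | tmul x y =>
    induction u with
    | zero => simp
    | add u v hu hv => simp only [TensorProduct.add_tmul, map_add, smul_add, hu, hv]
    | tmul u v =>
      simp [ydTensorMul_tmul, TensorProduct.smul_tmul', Finset.smul_sum, mul_assoc]

/-- For an integral `Λ`, `S(a) Λ₍₁₎ ⊗ Λ₍₂₎ = a⁽¹⁾ . Λ₍₁₎ ⊗ a⁽²⁾ Λ₍₂₎`: both sides are
`S(a₍₁₎) Δ(a₍₂₎ Λ)`. -/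
theorem ydAntipode_smul_comul_integral {Λ : A} (hΛ : ∀ a : A, a * Λ = counit (R := K) a • Λ)
    (a : A) : ydAntipode K G a • comul (R := K) Λ
      = ydTensorMul K (MonoidAlgebra K G) A ((1 ⊗ₜ a) ⊗ₜ comul Λ) := by
  rw [← sweedler_ydAntipode_smul_comul K G a]
  have h1 := sweedler_counit_right K a
    ((LinearMap.toSpanSingleton A (A ⊗[K] A) (comul (R := K) Λ)).restrictScalars K ∘ₗ
      ydAntipode K G)
  simp only [LinearMap.comp_apply, LinearMap.restrictScalars_apply,
    LinearMap.toSpanSingleton_apply] at h1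
  rw [← h1, sweedler, sweedler, TensorProduct.sum_tmul, map_sum]
  refine Finset.sum_congr rfl fun i _ => ?_
  rw [← smul_ydTensorMul, ← comul_mul (H := MonoidAlgebra K G), hΛ, map_smul, smul_comm]

theorem ydTensorMul_one_tmul_sum {ι : Type*} (s : Finset ι) (l r : ι → A) (a : A) :
    ydTensorMul K (MonoidAlgebra K G) A ((1 ⊗ₜ a) ⊗ₜ ∑ i ∈ s, l i ⊗ₜ[K] r i)
      = ∑ i ∈ s, ∑ g : G, ydPhi K g (l i) ⊗ₜ (ydProj K g a * r i) := by
  simp [TensorProduct.tmul_sum, ydTensorMul_tmul]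

variable (G A) in
/-- If `S(a) = 0`, then every homogeneous component of `a` satisfies
`g . Λ₍₁₎ ⊗ p_g(a) Λ₍₂₎ = 0`, whence `p_g(a) = S(Λ₍₁₎) p_g(a) Λ₍₂₎ = 0` by commutativity. -/
theorem ydAntipode_injective [IsSemisimpleRing A] :
    Function.Injective (ydAntipode K G : A →ₗ[K] A) := by
  classical
  obtain ⟨Λ, hΛ1, hΛ⟩ := exists_integral (ydCounit K G A)
  rw [injective_iff_map_eq_zero]
  intro a ha
  rw [← sum_ydProj K (G := G) a]
  refine Finset.sum_eq_zero fun g _ => ?_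
  have h := ydAntipode_smul_comul_integral (G := G) K hΛ (ydProj K g a)
  rw [ydAntipode_ydProj, ha, map_zero, zero_smul, ← (ℛ K Λ).eq, ydTensorMul_one_tmul_sum] at h
  have h2 := congrArg (LinearMap.mul' K A ∘ₗ
    TensorProduct.map (ydAntipode K G ∘ₗ ydPhi K g⁻¹) LinearMap.id) h
  have h3 : ∀ x y : A, ∑ k : G, ydPhi K k x ⊗ₜ[K] (ydProj K k (ydProj K g a) * y)
      = ydPhi K g x ⊗ₜ (ydProj K g a * y) := by
    intro x y
    rw [Finset.sum_eq_single g] <;> simp +contextual [ydProj_ydProj]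
  simp only [h3, map_zero, map_sum, LinearMap.comp_apply, TensorProduct.map_tmul, ydPhi_ydPhi,
    inv_mul_cancel, ydPhi_one, LinearMap.id_apply, LinearMap.mul'_apply] at h2
  have h4 := antipode_mul_id (K := K) (H := MonoidAlgebra K G) Λ
  rw [show counit (R := K) Λ = 1 from hΛ1, one_smul, ← (ℛ K Λ).eq] at h4
  simp only [map_sum, TensorProduct.map_tmul, LinearMap.id_apply, LinearMap.mul'_apply] at h4
  calc ydProj K g a = ydProj K g a * 1 := (mul_one _).symm
    _ = 0 := by
      rw [← h4, h2, Finset.mul_sum]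
      exact Finset.sum_congr rfl fun i _ => by ring

/-- A commutative semisimple Yetter-Drinfel'd Hopf algebra is finite-dimensional: the antipode is
injective, and `S(a) = S(a) Λ₍₁₎ S(Λ₍₂₎)` lies in a finite-dimensional subspace. -/
theorem finite_of_isSemisimpleRing (K G A : Type*) [Field K] [CommGroup G] [Fintype G]
    [CommRing A] [Algebra K A] [Coalgebra K A] [Module (MonoidAlgebra K G) A]
    [IsScalarTower K (MonoidAlgebra K G) A] [YetterDrinfeldHopfAlgebra K (MonoidAlgebra K G) A]
    [IsSemisimpleRing A] : Module.Finite K A := by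
  classical
  obtain ⟨Λ, hΛ1, hΛ⟩ := exists_integral (ydCounit K G A)
  let b := Module.Basis.ofVectorSpace K A
  obtain ⟨c, hc⟩ := TensorProduct.eq_repr_basis_right b (comul (R := K) Λ)
  rw [Finsupp.sum] at hc
  let W : Submodule K A := Submodule.span K
    (Set.range fun p : G × c.support => ydPhi K p.1 (c p.2))
  let U : Submodule K A := Submodule.span K
    (Set.range fun p : c.support => ydAntipode K G (b p))
  -- apply a coordinate functional to the second factor of `S(a) Λ₍₁₎ ⊗ Λ₍₂₎`
  have hW : ∀ (a : A), ∀ i, ydAntipode K G a * c i ∈ W := by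
    intro a i
    have h := congrArg
      ((TensorProduct.rid K A).toLinearMap ∘ₗ TensorProduct.map LinearMap.id (b.coord i))
      (ydAntipode_smul_comul_integral (G := G) K hΛ a)
    rw [← hc, ydTensorMul_one_tmul_sum] at h
    simp only [Finset.smul_sum, TensorProduct.smul_tmul', map_sum, LinearMap.comp_apply,
      TensorProduct.map_tmul, LinearMap.id_apply, LinearEquiv.coe_coe, TensorProduct.rid_tmul,
      Module.Basis.coord_apply, Module.Basis.repr_self, Finsupp.single_apply, ite_smul, one_smul,
      zero_smul, smul_eq_mul, Finset.sum_ite_eq', Finsupp.mem_support_iff] at h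
    have h0 : (if c i ≠ 0 then ydAntipode K G a * c i else 0) = ydAntipode K G a * c i := by
      split_ifs with hi
      · rfl
      · rw [not_not.1 hi, mul_zero]
    rw [← h0, h]
    exact Submodule.sum_mem _ fun j hj => Submodule.sum_mem _ fun g _ => Submodule.smul_mem _ _
      (Submodule.subset_span ⟨(g, ⟨j, hj⟩), rfl⟩)
  have hS : ∀ a : A, ydAntipode K G a ∈ W * U := by
    intro a
    have h4 := id_mul_antipode (K := K) (H := MonoidAlgebra K G) Λ
    rw [show counit (R := K) Λ = 1 from hΛ1, one_smul, ← hc] at h4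
    simp only [map_sum, TensorProduct.map_tmul, LinearMap.id_apply, LinearMap.mul'_apply] at h4
    rw [← mul_one (ydAntipode K G a), ← h4, Finset.mul_sum]
    refine Submodule.sum_mem _ fun i hi => ?_
    rw [← mul_assoc]
    exact Submodule.mul_mem_mul (hW a i) (Submodule.subset_span ⟨⟨i, hi⟩, rfl⟩)
  have hfg : (W * U).FG :=
    (Submodule.fg_span (Set.finite_range _)).mul (Submodule.fg_span (Set.finite_range _))
  have : Module.Finite K (W * U : Submodule K A) := Module.Finite.iff_fg.2 hfg
  refine Module.Finite.of_injective ((ydAntipode K G).codRestrict (W * U) hS) ?_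
  intro x y hxy
  exact ydAntipode_injective K G A (congrArg Subtype.val hxy)

variable (G A) in
theorem ydAntipode_surjective [IsSemisimpleRing A] :
    Function.Surjective (ydAntipode K G : A →ₗ[K] A) :=
  have := finite_of_isSemisimpleRing K G A
  LinearMap.injective_iff_surjective.1 (ydAntipode_injective K G A)

end Integral

/-! ### Primitive idempotents -/

section PrimitiveIdempotents

theorem IsPrimitiveIdempotent.map {A B : Type*} [Ring A] [Ring B] {e : A}
    (he : IsPrimitiveIdempotent e) (σ : A ≃+* B) : IsPrimitiveIdempotent (σ e) := by
  refine ⟨he.1.map σ, (map_ne_zero_iff σ σ.injective).2 he.2.1, fun p q hp hq hpq hqp h => ?_⟩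
  have h1 := he.2.2 (σ.symm p) (σ.symm q) (hp.map σ.symm) (hq.map σ.symm)
    (by rw [← map_mul, hpq, map_zero]) (by rw [← map_mul, hqp, map_zero])
    (by rw [← map_add, h, σ.symm_apply_apply])
  simpa using h1

variable {A : Type*} [CommRing A] {e f : A}

theorem IsPrimitiveIdempotent.mul_eq_self_or_zero (he : IsPrimitiveIdempotent e) {p : A}
    (hp : IsIdempotentElem p) : e * p = e ∨ e * p = 0 := by
  have h1 : e * e = e := he.1
  have h2 : p * p = p := hp
  rcases he.2.2 (e * p) (e * (1 - p)) (he.1.mul hp) (he.1.mul hp.one_sub)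
    (by linear_combination -(e * e) * h2) (by linear_combination -(e * e) * h2)
    (by ring) with h | h
  · exact Or.inr h
  · exact Or.inl (by linear_combination -h)

theorem IsPrimitiveIdempotent.mul_eq_zero_of_ne (he : IsPrimitiveIdempotent e)
    (hf : IsPrimitiveIdempotent f) (h : e ≠ f) : e * f = 0 := by
  rcases he.mul_eq_self_or_zero hf.1 with h1 | h1
  · rcases hf.mul_eq_self_or_zero he.1 with h2 | h2
    · exact absurd (h1.symm.trans ((mul_comm e f).trans h2)) h
    · rwa [mul_comm]
  · exact h1

/-- Over an algebraically closed field, `A e = K e` for a primitive idempotent `e` of a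
finite-dimensional commutative semisimple algebra `A`. -/
theorem IsPrimitiveIdempotent.exists_mul_eq_smul (K : Type*) [Field K] [IsAlgClosed K]
    [Algebra K A] [Module.Finite K A] [IsSemisimpleRing A] (he : IsPrimitiveIdempotent e) (a : A) :
    ∃ c : K, a * e = c • e := by
  have hee : e * e = e := he.1
  let E : Submodule K A := LinearMap.range (LinearMap.mulLeft K e)
  have hE : ∀ x ∈ E, LinearMap.mulLeft K a x ∈ E := by
    rintro _ ⟨y, rfl⟩
    exact ⟨a * y, by simp only [LinearMap.mulLeft_apply]; ring⟩
  have : Nontrivial E := ⟨⟨⟨e, e, hee⟩, 0, fun h => he.2.1 (congrArg Subtype.val h)⟩⟩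
  obtain ⟨c, hc⟩ := Module.End.exists_eigenvalue ((LinearMap.mulLeft K a).restrict hE)
  obtain ⟨⟨x, y, hy⟩, hx⟩ := hc.exists_hasEigenvector
  have hx0 : x ≠ 0 := fun h => hx.2 (Subtype.ext h)
  have hax : a * x = c • x := congrArg Subtype.val hx.apply_eq_smul
  have hxe : x * e = x := by
    rw [← hy, LinearMap.mulLeft_apply]
    linear_combination y * hee
  -- the annihilator of `(a - c) e` is an ideal that meets `A e`, hence contains `e`
  let d : A := a * e - c • e
  let J : Ideal A := LinearMap.ker (LinearMap.toSpanSingleton A A d)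
  have hJ : ∀ y, y ∈ J ↔ y * d = 0 := fun y => by simp [J]
  obtain ⟨C, hC⟩ := exists_isCompl J
  have h0 : ∀ z ∈ J, z ∈ C → z = 0 := Submodule.disjoint_def.1 hC.disjoint
  obtain ⟨j, hj, w, hw, hjw⟩ := Submodule.mem_sup.1
    (hC.sup_eq_top ▸ Submodule.mem_top : (1 : A) ∈ J ⊔ C)
  have hjw0 : j * w = 0 := h0 _ (J.mul_mem_right _ hj) (C.mul_mem_left _ hw)
  have hjj : IsIdempotentElem j := by
    have : j * j = j := by linear_combination j * hjw - hjw0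
    exact this
  refine ⟨c, ?_⟩
  rw [← sub_eq_zero]
  change d = 0
  rcases he.mul_eq_self_or_zero hjj with h | h
  · have hd : d * e = d := by
      simp only [d, sub_mul, smul_mul_assoc, mul_assoc, hee]
    have hd2 : d * (e * j) = 0 := by
      linear_combination e * (hJ j).1 hj
    rw [← hd, ← h, hd2]
  · have hxJ : x ∈ J := by
      rw [hJ]
      simp only [d, mul_sub, mul_smul_comm, hxe]
      rw [← hax]
      linear_combination a * hxe
    have hxw : x * w = x := by
      linear_combination x * hjw - x * h + j * hxe
    exact absurd (h0 x hxJ (hxw ▸ C.mul_mem_left x hw)) hx0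

theorem isIdealSet_of_mul_mem {K : Type*} [Field K] [Algebra K A] (N : Submodule K A)
    (h : ∀ a, ∀ x ∈ N, a * x ∈ N) : IsIdealSet (N : Set A) :=
  ⟨{ carrier := N, add_mem' := N.add_mem, zero_mem' := N.zero_mem, smul_mem' := h }, rfl⟩

end PrimitiveIdempotents

/-! ### Characters -/

section Characters

theorem sum_monoidHom_apply {K G : Type*} [Field K] [IsAlgClosed K] [CharZero K] [CommGroup G]
    [Finite G] [Fintype (G →* Kˣ)] [DecidableEq G] (x : G) :
    ∑ γ : G →* Kˣ, (γ x : K) = if x = 1 then (Fintype.card (G →* Kˣ) : K) else 0 := by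
  split_ifs with hx
  · simp [hx]
  · have : NeZero (Monoid.exponent G : K) := ⟨by
      exact_mod_cast Monoid.exponent_ne_zero_of_finite⟩
    obtain ⟨χ, hχ⟩ := CommGroup.exists_apply_ne_one_of_hasEnoughRootsOfUnity G K hx
    have h : (χ x : K) * ∑ γ : G →* Kˣ, (γ x : K) = ∑ γ : G →* Kˣ, (γ x : K) := by
      rw [Finset.mul_sum]
      conv_rhs => rw [← Equiv.sum_comp (Equiv.mulLeft χ)]
      simp
    have h1 : ((χ x : K) - 1) * ∑ γ : G →* Kˣ, (γ x : K) = 0 := by linear_combination h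
    refine (mul_eq_zero.1 h1).resolve_left fun h2 => hχ (Units.ext ?_)
    simpa [sub_eq_zero] using h2

theorem mul_mem_charPerp {K G : Type*} [Field K] [Group G] {Q : Set (G →* Kˣ)} {g h : G}
    (hg : g ∈ charPerp Q) (hh : h ∈ charPerp Q) : g * h ∈ charPerp Q := fun γ hγ => by
  rw [map_mul, hg γ hγ, hh γ hγ, one_mul]

theorem inv_mem_charPerp {K G : Type*} [Field K] [Group G] {Q : Set (G →* Kˣ)} {g : G}
    (hg : g ∈ charPerp Q) : g⁻¹ ∈ charPerp Q := fun γ hγ => by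
  rw [map_inv, hg γ hγ, inv_one]

end Characters

/-! ### Homogeneous components of primitive idempotents -/

section Homogeneous

variable (K : Type*) {G A : Type*} [Field K] [CommGroup G] [CommRing A] [Algebra K A]
  [Coalgebra K A] [Module (MonoidAlgebra K G) A] [IsScalarTower K (MonoidAlgebra K G) A]
  [YetterDrinfeldHopfAlgebra K (MonoidAlgebra K G) A]

theorem ydPhi_mem_ydIdeal (e : A) {g : G} (hg : g ∈ charPerp (ydIsotropy (G := G) K e)) :
    ydPhi K g e ∈ ydIdeal (G := G) K e := Submodule.subset_span ⟨g, hg, rfl⟩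

variable (A) in
/-- `φ_g` as a ring automorphism. -/
noncomputable def ydPhiEquiv (g : G) : A ≃+* A where
  toFun := ydPhi K g
  invFun := ydPhi K g⁻¹
  left_inv a := by rw [ydPhi_ydPhi, inv_mul_cancel, ydPhi_one]
  right_inv a := by rw [ydPhi_ydPhi, mul_inv_cancel, ydPhi_one]
  map_mul' := ydPhi_mul K g
  map_add' := map_add _

theorem IsPrimitiveIdempotent.ydPhi {e : A} (he : IsPrimitiveIdempotent e) (g : G) :
    IsPrimitiveIdempotent (ydPhi K g e) :=
  he.map (ydPhiEquiv K A g)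

variable [Fintype G]

variable (A) in
/-- `ψ_γ` as a ring automorphism. -/
noncomputable def ydPsiEquiv (γ : G →* Kˣ) : A ≃+* A where
  toFun := ydPsi K γ
  invFun := ydPsi K γ⁻¹
  left_inv a := by rw [ydPsi_ydPsi, show γ⁻¹ * γ = 1 by ext; simp, ydPsi_one]
  right_inv a := by rw [ydPsi_ydPsi, show γ * γ⁻¹ = 1 by ext; simp, ydPsi_one]
  map_mul' := ydPsi_mul K γ
  map_add' := map_add _

theorem ydIsotropy_ydPhi (g : G) (e : A) :
    ydIsotropy (G := G) K (ydPhi K g e) = ydIsotropy (G := G) K e := by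
  ext γ
  simp only [ydIsotropy, Set.mem_ofPred_eq, ydPsi_ydPhi]
  exact (ydPhiEquiv K A g).injective.eq_iff

theorem ydProj_eq_sum_ydPsi [IsAlgClosed K] [CharZero K] [Fintype (G →* Kˣ)] (g : G) (a : A) :
    (Fintype.card (G →* Kˣ) : K) • ydProj K g a = ∑ γ : G →* Kˣ, (γ g⁻¹ : K) • ydPsi K γ a := by
  classical
  simp only [ydPsi_eq_sum, Finset.smul_sum, smul_smul]
  rw [Finset.sum_comm]
  have h : ∀ h : G, ∑ γ : G →* Kˣ, ((γ g⁻¹ : K) * γ h) • ydProj K h a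
      = if h = g then (Fintype.card (G →* Kˣ) : K) • ydProj K g a else 0 := by
    intro h
    rw [← Finset.sum_smul]
    have h1 := sum_monoidHom_apply (K := K) (g⁻¹ * h)
    simp only [map_mul, Units.val_mul] at h1
    rw [h1, inv_mul_eq_one, eq_comm (a := g)]
    split_ifs with hg
    · rw [hg]
    · rw [zero_smul]
  simp only [h, Finset.sum_ite_eq', Finset.mem_univ, if_true]

/-- If `Q` is the isotropy group of the primitive idempotent `f`, then the component of `f` in a
degree `g ∈ Q^⊥` satisfies `|Ĝ| p_g(f) f = |Q| f`, because the translates of `f` under the characters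
outside `Q` are orthogonal to `f`. -/
theorem IsPrimitiveIdempotent.ydProj_mul_self_ne_zero [IsAlgClosed K] [CharZero K] {f : A}
    (hf : IsPrimitiveIdempotent f) {g : G} (hg : g ∈ charPerp (ydIsotropy (G := G) K f)) :
    ydProj K g f * f ≠ 0 := by
  classical
  cases nonempty_fintype (G →* Kˣ)
  intro h0
  have h := congrArg (· * f) (ydProj_eq_sum_ydPsi K g f)
  simp only [smul_mul_assoc, h0, smul_zero, Finset.sum_mul] at h
  have hγ : ∀ γ : G →* Kˣ, (γ g⁻¹ : K) • (ydPsi K γ f * f)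
      = if γ ∈ ydIsotropy (G := G) K f then f else 0 := by
    intro γ
    split_ifs with hQ
    · have h1 : ydPsi K γ f = f := hQ
      rw [h1, map_inv, hg γ hQ, inv_one, Units.val_one, one_smul]
      exact hf.1
    · have h1 : ydPsi K γ f * f = 0 :=
        (hf.map (ydPsiEquiv K A γ)).mul_eq_zero_of_ne hf hQ
      rw [h1, smul_zero]
  simp only [hγ, ← Finset.sum_filter, Finset.sum_const] at h
  rw [← Nat.cast_smul_eq_nsmul K, eq_comm, smul_eq_zero, Nat.cast_eq_zero,
    Finset.card_eq_zero] at h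
  refine h.elim (fun h => ?_) hf.2.1
  have h1 : (1 : G →* Kˣ) ∈ ydIsotropy (G := G) K f := ydPsi_one K f
  exact Finset.notMem_empty (1 : G →* Kˣ) (h ▸ Finset.mem_filter.2 ⟨Finset.mem_univ _, h1⟩)

/-- An isotropy character `γ` with `γ(g) ≠ 1` acts on the line `K f` both trivially and, on
`p_g(b) f`, by `γ(g)`. -/
theorem ydProj_mul_eq_zero [IsAlgClosed K] [IsSemisimpleRing A] {f : A}
    (hf : IsPrimitiveIdempotent f) {g : G} (hg : g ∉ charPerp (ydIsotropy (G := G) K f)) (b : A) :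
    ydProj K g b * f = 0 := by
  have := finite_of_isSemisimpleRing K G A
  obtain ⟨c, hc⟩ := hf.exists_mul_eq_smul K (ydProj K g b)
  simp only [charPerp, Set.mem_ofPred_eq, not_forall] at hg
  obtain ⟨γ, hγ, hg⟩ := hg
  have hγ' : ydPsi K γ f = f := hγ
  have h := ydPsi_mul K γ (ydProj K g b) f
  rw [ydPsi_ydProj, hγ', smul_mul_assoc, hc, map_smul, hγ', smul_smul, eq_comm] at h
  have h1 : (((γ g : K) - 1) * c) • f = 0 := by rw [sub_mul, one_mul, sub_smul, h, sub_self]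
  rcases smul_eq_zero.1 h1 with h2 | h2
  · rcases mul_eq_zero.1 h2 with h3 | h3
    · exact absurd (Units.ext (by simpa [sub_eq_zero] using h3)) hg
    · rw [hc, h3, zero_smul]
  · exact absurd h2 hf.2.1

theorem ydAntipode_mul_ydAntipode (a b : A) : ydAntipode K G b * ydAntipode K G a
    = ydAntipode K G (∑ g : G, ydProj K g a * ydPhi K g⁻¹ b) := by
  classical
  rw [map_sum]
  conv_lhs => rw [← sum_ydProj K (G := G) a, map_sum, Finset.mul_sum]
  refine Finset.sum_congr rfl fun g _ => ?_
  rw [ydAntipode_mul, Finset.sum_eq_single g]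
  · simp [ydProj_ydProj, ydPhi_ydPhi, ydPhi_one]
  · intro h _ hh
    simp [ydProj_ydProj, hh]
  · simp

theorem mul_mem_ydIdeal [IsAlgClosed K] [IsSemisimpleRing A] {e : A}
    (he : IsPrimitiveIdempotent e) (a : A) {x : A} (hx : x ∈ ydIdeal (G := G) K e) :
    a * x ∈ ydIdeal (G := G) K e := by
  have := finite_of_isSemisimpleRing K G A
  induction hx using Submodule.span_induction with
  | zero => rw [mul_zero]; exact Submodule.zero_mem _
  | add x y _ _ hx hy => rw [mul_add]; exact Submodule.add_mem _ hx hy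
  | smul r x _ hx => rw [mul_smul_comm]; exact Submodule.smul_mem _ _ hx
  | mem x hx =>
    obtain ⟨g, hg, rfl⟩ := hx
    obtain ⟨c, hc⟩ := (he.ydPhi K g).exists_mul_eq_smul K a
    rw [hc]
    exact Submodule.smul_mem _ _ (ydPhi_mem_ydIdeal K e hg)

/-- In `S(b) S(φ_h(e)) = ∑ g, S(p_g(b) φ_{g⁻¹h}(e))` only the terms with `g ∈ Q_e^⊥` survive, so the
product stays in the image of `I_e`. -/
theorem mul_mem_map_ydAntipode_ydIdeal [IsAlgClosed K] [IsSemisimpleRing A] {e : A}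
    (he : IsPrimitiveIdempotent e) (a : A) {x : A}
    (hx : x ∈ (ydIdeal (G := G) K e).map (ydAntipode K G)) :
    a * x ∈ (ydIdeal (G := G) K e).map (ydAntipode K G) := by
  obtain ⟨b, rfl⟩ := ydAntipode_surjective K G A a
  obtain ⟨y, hy, rfl⟩ := hx
  induction hy using Submodule.span_induction with
  | zero => rw [map_zero, mul_zero]; exact Submodule.zero_mem _
  | add x y _ _ hx hy => rw [map_add, mul_add]; exact Submodule.add_mem _ hx hy
  | smul r x _ hx => rw [map_smul, mul_smul_comm]; exact Submodule.smul_mem _ _ hx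
  | mem x hx =>
    obtain ⟨h, hh, rfl⟩ := hx
    rw [mul_comm, ydAntipode_mul_ydAntipode]
    refine Submodule.mem_map_of_mem (Submodule.sum_mem _ fun g _ => ?_)
    rw [ydPhi_ydPhi]
    by_cases hg : g ∈ charPerp (ydIsotropy (G := G) K e)
    · exact mul_mem_ydIdeal K he _
        (ydPhi_mem_ydIdeal K e (mul_mem_charPerp (inv_mem_charPerp hg) hh))
    · rw [ydProj_mul_eq_zero K (he.ydPhi K (g⁻¹ * h)) (by rwa [ydIsotropy_ydPhi])]
      exact Submodule.zero_mem _

theorem ydPhi_mem_of_isIdealSet [IsAlgClosed K] [CharZero K] [IsSemisimpleRing A] {e : A}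
    (he : IsPrimitiveIdempotent e) (I : Ideal A) (heI : e ∈ I)
    (hI : IsIdealSet (ydAntipode K G '' (I : Set A))) {g : G}
    (hg : g ∈ charPerp (ydIsotropy (G := G) K e)) : ydPhi K g e ∈ I := by
  classical
  have := finite_of_isSemisimpleRing K G A
  obtain ⟨J, hJ⟩ := hI
  set f := ydPhi K g e with hf
  have hfp : IsPrimitiveIdempotent f := he.ydPhi K g
  have heJ : ydAntipode K G e ∈ J := by
    rw [← SetLike.mem_coe, hJ]
    exact ⟨e, heI, rfl⟩
  -- the preimage of `S(p_{g⁻¹}(f)) S(e)` under the antipode is `p_{g⁻¹}(f) f`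
  have h1 : ydAntipode K G (ydProj K g⁻¹ f * f) ∈ J := by
    have h2 := J.mul_mem_right (ydAntipode K G (ydProj K g⁻¹ f)) heJ
    rw [ydAntipode_mul_ydAntipode, Finset.sum_eq_single g⁻¹] at h2
    · simpa [ydProj_ydProj, ← hf] using h2
    · intro h _ hh
      simp [ydProj_ydProj, hh]
    · simp
  rw [← SetLike.mem_coe, hJ] at h1
  obtain ⟨x, hx, hxf⟩ := h1
  rw [ydAntipode_injective K G A hxf] at hx
  obtain ⟨c, hc⟩ := hfp.exists_mul_eq_smul K (ydProj K g⁻¹ f)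
  have hne := hfp.ydProj_mul_self_ne_zero K (g := g⁻¹)
    (by rw [ydIsotropy_ydPhi]; exact inv_mem_charPerp hg)
  rw [hc] at hx hne
  have hc0 : c ≠ 0 := fun h => hne (by rw [h, zero_smul])
  have h3 := I.mul_mem_left (algebraMap K A c⁻¹) hx
  rwa [← Algebra.smul_def, smul_smul, inv_mul_cancel₀ hc0, one_smul] at h3

end Homogeneous

theorem theorem3p4 {K G A : Type*} [Field K] [IsAlgClosed K] [CharZero K]
    [CommGroup G] [Finite G] [CommRing A] [Algebra K A] [Coalgebra K A]
    [Module (MonoidAlgebra K G) A] [IsScalarTower K (MonoidAlgebra K G) A]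
    [YetterDrinfeldHopfAlgebra K (MonoidAlgebra K G) A] [IsSemisimpleRing A]
    (e : A) (he : IsPrimitiveIdempotent e) :
    -- `I_e` is an ideal
    IsIdealSet (ydIdeal K G e : Set A) ∧
    -- `S_A(I_e)` is an ideal
    IsIdealSet
      (YetterDrinfeldHopfAlgebra.antipode (K := K) (H := MonoidAlgebra K G) '' (ydIdeal K G e : Set A)) ∧
    -- `I_e` is contained in every ideal that contains `e` and whose image is an ideal
    ∀ I : Ideal A, e ∈ I →
      IsIdealSet (YetterDrinfeldHopfAlgebra.antipode (K := K) (H := MonoidAlgebra K G) '' (I : Set A)) →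
      (ydIdeal K G e : Set A) ⊆ I := by
  cases nonempty_fintype G
  refine ⟨isIdealSet_of_mul_mem _ fun a x hx => mul_mem_ydIdeal K he a hx, ?_, ?_⟩
  · exact isIdealSet_of_mul_mem ((ydIdeal K G e).map (ydAntipode K G))
      fun a x hx => mul_mem_map_ydAntipode_ydIdeal K he a hx
  · intro I heI hI
    have h : ydIdeal K G e ≤ I.restrictScalars K := by
      refine Submodule.span_le.2 ?_
      rintro _ ⟨g, hg, rfl⟩
      exact ydPhi_mem_of_isIdealSet K he I heI hI hg
    exact h
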